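/- Let $\Lambda_{\mathbb Q}$ be the algebra of symmetric functions over $\mathbb Q$ in the variables $x=(x_1,x_2,\dots)$, with elementary, complete homogeneous and power sum symmetric functions $e_n$, $h_n$, $p_n$, and let $\omega$ be the algebra endomorphism of $\Lambda_{\mathbb Q}$ with $\omega(e_n)=h_n$ for $n\ge 1$. For $f\in\Lambda_{\mathbb Q}$ let $f(x/y)=\omega_y f(x,y)$, where $y=(y_1,y_2,\dots)$ is a second set of variables and $\omega_y$ is $\omega$ acting on the $y$-variables only; the shiftification of $f$ is $f(x/x)$. A parking function of length $n$ is a sequence $(a_1,\dots,a_n)$ of positive integers whose increasing rearrangement $b_1\le\cdots\le b_n$ satisfies $b_i\le i$ for all $i$; let $\mathrm{PF}_n$ be the Frobenius characteristic of the action of the symmetric group $\mathfrak S_n$ on the parking functions of length $n$ by permuting coordinates, and let $\mathrm{SH}_n(x)=\mathrm{PF}_n(x/x)$ be its shiftification. Then for every $n\ge 1$ $$ \mathrm{SH}_n=\sum_{\substack{\lambda\vdash n\\ \text{all } \lambda_i \text{ odd}}} z_\lambda^{-1}\,2^{\ell(\lambda)}(n+1)^{\ell(\lambda)-1}\,p_\lambda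 , $$ where $\ell(\lambda)$ is the number of parts of $\lambda$, $p_\lambda=p_{\lambda_1}p_{\lambda_2}\cdots$, and $z_\lambda=\prod_{i\ge1} i^{m_i}m_i!$ with $m_i$ the number of parts of $\lambda$ equal to $i$. -/

import Mathlib

namespace ShiftedParking

open MvPowerSeries

/-! ### The ring of symmetric functions -/

/-- The `ℚ`-algebra `Λ_ℚ` of symmetric functions in the variables `x₀, x₁, x₂, …`: the formal power
series of bounded degree whose coefficients are invariant under permuting the variables. -/
def Sym : Subalgebra ℚ (MvPowerSeries ℕ ℚ) where
  carrier := {f | (∀ (w : Equiv.Perm ℕ) (a : ℕ →₀ ℕ), coeff (a.embDomain w.toEmbedding) f = coeff a f) ∧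
    ∃ d : ℕ, ∀ a : ℕ →₀ ℕ, d < a.degree → coeff a f = 0}
  mul_mem' := by
    rintro f g ⟨hf, d, hd⟩ ⟨hg, d', hd'⟩
    refine ⟨fun w a => ?_, d + d', fun a ha => ?_⟩
    · have key : ∀ h : MvPowerSeries ℕ ℚ,
          (∀ b : ℕ →₀ ℕ, coeff (b.embDomain w.toEmbedding) h = coeff b h) →
            killCompl w.toEmbedding h = h := by
        intro h hh
        ext b
        rw [coeff_killCompl, hh]
      rw [← coeff_killCompl, map_mul, key f (hf w), key g (hg w)]
    · rw [coeff_mul]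
      refine Finset.sum_eq_zero fun p hp => ?_
      rw [Finset.HasAntidiagonal.mem_antidiagonal] at hp
      have hdeg : p.1.degree + p.2.degree = a.degree := by rw [← hp, map_add]
      rcases lt_or_ge d p.1.degree with h | h
      · rw [hd _ h, zero_mul]
      · rw [hd' _ (by omega), mul_zero]
  add_mem' := by
    rintro f g ⟨hf, d, hd⟩ ⟨hg, d', hd'⟩
    refine ⟨fun w a => by rw [map_add, map_add, hf, hg], max d d', fun a ha => ?_⟩
    rw [map_add, hd _ (lt_of_le_of_lt (le_max_left _ _) ha),
      hd' _ (lt_of_le_of_lt (le_max_right _ _) ha), add_zero]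
  algebraMap_mem' := by
    intro r
    refine ⟨fun w a => ?_, 0, fun a ha => ?_⟩
    · rw [← coeff_killCompl, AlgHom.commutes]
    · classical
      rw [MvPowerSeries.algebraMap_apply, coeff_C, if_neg]
      · rintro rfl
        simp at ha

theorem degree_embDomain {σ τ : Type*} (w : σ ↪ τ) (a : σ →₀ ℕ) :
    (a.embDomain w).degree = a.degree := by
  simp [Finsupp.degree_apply, Finsupp.support_embDomain]

open Classical in
/-- The elementary symmetric function `e_n`: the sum of all squarefree monomials of degree `n`. -/
noncomputable def e (n : ℕ) : Sym :=
  ⟨fun a => if a.degree = n ∧ ∀ i, a i ≤ 1 then 1 else 0, by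
    refine ⟨fun w a => ?_, n, fun a ha => if_neg fun h => by omega⟩
    refine if_congr ?_ rfl rfl
    rw [degree_embDomain]
    refine and_congr Iff.rfl ⟨fun h i => ?_, fun h i => ?_⟩
    · have := h (w i)
      rwa [← Equiv.coe_toEmbedding, Finsupp.embDomain_apply_self] at this
    · have := h (w.symm i)
      rwa [← Finsupp.embDomain_apply_self w.toEmbedding a (w.symm i), Equiv.coe_toEmbedding,
        Equiv.apply_symm_apply] at this⟩

open Classical in
/-- The complete homogeneous symmetric function `h_n`: the sum of all monomials of degree `n`. -/
noncomputable def h (n : ℕ) : Sym :=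
  ⟨fun a => if a.degree = n then 1 else 0, by
    refine ⟨fun w a => ?_, n, fun a ha => if_neg fun h => by omega⟩
    refine if_congr ?_ rfl rfl
    rw [degree_embDomain]⟩

open Classical in
/-- The power sum symmetric function `p_k = ∑ᵢ xᵢᵏ`, for `k ≥ 1`. -/
noncomputable def p (k : ℕ) : Sym :=
  ⟨fun a => if ∃ i, a = Finsupp.single i k then 1 else 0, by
    refine ⟨fun w a => ?_, k, fun a ha => if_neg ?_⟩
    · refine if_congr ⟨?_, ?_⟩ rfl rfl
      · rintro ⟨i, hi⟩
        refine ⟨w.symm i, Finsupp.embDomain_injective w.toEmbedding ?_⟩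
        rw [hi, Finsupp.embDomain_single]
        simp
      · rintro ⟨i, rfl⟩
        exact ⟨w i, by rw [Finsupp.embDomain_single]; rfl⟩
    · rintro ⟨i, rfl⟩
      simp at ha⟩

/-- `p_λ = p_{λ₁} p_{λ₂} ⋯` for a partition `λ` of `n`. -/
noncomputable def pPart {n : ℕ} (l : n.Partition) : Sym := (l.parts.map p).prod

/-! ### The involution `ω` -/

/-- The algebra homomorphism `ℚ[X₀, X₁, …] → Λ_ℚ` with `Xᵢ ↦ e_{i+1}`. -/
noncomputable def eHom : MvPolynomial ℕ ℚ →ₐ[ℚ] Sym := MvPolynomial.aeval fun i => e (i + 1)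

/-- Setting `xᵢ = 0` for `i ≥ N` in a symmetric function. -/
noncomputable def restrict (N : ℕ) : Sym →ₐ[ℚ] MvPowerSeries (Fin N) ℚ :=
  (killCompl Fin.valEmbedding).comp Sym.val

theorem coeff_restrict (N : ℕ) (f : Sym) (a : Fin N →₀ ℕ) :
    coeff a (restrict N f) = coeff (a.embDomain Fin.valEmbedding) (f : MvPowerSeries ℕ ℚ) :=
  coeff_killCompl _ _

theorem coeff_esymm (N k : ℕ) (a : Fin N →₀ ℕ) : (MvPolynomial.esymm (Fin N) ℚ k).coeff a =
    if a.degree = k ∧ ∀ i, a i ≤ 1 then 1 else 0 := by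
  classical
  rw [MvPolynomial.esymm_eq_sum_monomial, MvPolynomial.coeff_sum]
  simp only [MvPolynomial.coeff_monomial]
  have hval : ∀ (t : Finset (Fin N)) (j : Fin N),
      (∑ i ∈ t, Finsupp.single i 1 : Fin N →₀ ℕ) j = if j ∈ t then 1 else 0 := by
    intro t j
    simp [Finsupp.finsetSum_apply, Finsupp.single_apply]
  have hdeg : ∀ t : Finset (Fin N), (∑ i ∈ t, Finsupp.single i 1 : Fin N →₀ ℕ).degree = t.card := by
    intro t
    simp
  split_ifs with ha
  · obtain ⟨h1, h2⟩ := ha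
    have hs : (∑ i ∈ a.support, Finsupp.single i 1 : Fin N →₀ ℕ) = a := by
      ext j
      rw [hval]
      have := h2 j
      split_ifs with hj
      · rw [Finsupp.mem_support_iff] at hj
        omega
      · rw [Finsupp.notMem_support_iff] at hj
        omega
    rw [Finset.sum_eq_single a.support, if_pos hs]
    · intro t _ hne
      refine if_neg fun hta => hne ?_
      ext j
      rw [Finsupp.mem_support_iff, ← hta, hval]
      simp
    · intro hn
      exfalso
      apply hn
      rw [Finset.mem_powersetCard]
      exact ⟨Finset.subset_univ _, by rw [← hdeg, hs, h1]⟩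
  · refine Finset.sum_eq_zero fun t ht => if_neg fun hta => ha ?_
    subst hta
    rw [hdeg]
    refine ⟨(Finset.mem_powersetCard.1 ht).2, fun j => ?_⟩
    rw [hval]
    split_ifs <;> omega

open Classical in
theorem restrict_e (N k : ℕ) :
    restrict N (e k) = (MvPolynomial.esymm (Fin N) ℚ k : MvPowerSeries (Fin N) ℚ) := by
  ext a
  rw [coeff_restrict, MvPolynomial.coeff_coe, coeff_esymm]
  change (if (a.embDomain Fin.valEmbedding).degree = k ∧
    ∀ i, (a.embDomain Fin.valEmbedding) i ≤ 1 then (1 : ℚ) else 0) = _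
  refine if_congr ?_ rfl rfl
  rw [degree_embDomain]
  refine and_congr Iff.rfl ⟨fun h i => ?_, fun h i => ?_⟩
  · have := h (Fin.valEmbedding i)
    rwa [Finsupp.embDomain_apply_self] at this
  · by_cases hi : i ∈ Set.range (Fin.valEmbedding : Fin N ↪ ℕ)
    · obtain ⟨j, rfl⟩ := hi
      rw [Finsupp.embDomain_apply_self]
      exact h j
    · rw [Finsupp.embDomain_of_notMem_range _ _ _ hi]
      omega

/-- Restricting a polynomial in `e₁, …, e_N` to `N` variables gives the same polynomial in the
elementary symmetric polynomials. -/
theorem restrict_eHom (N : ℕ) (P : MvPolynomial (Fin N) ℚ) :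
    restrict N (eHom (MvPolynomial.rename Fin.val P)) =
      ((MvPolynomial.esymmAlgHom (Fin N) ℚ N P : MvPolynomial (Fin N) ℚ) :
        MvPowerSeries (Fin N) ℚ) := by
  have : ((restrict N).comp eHom).comp (MvPolynomial.rename Fin.val) =
      ((MvPolynomial.coeToMvPowerSeries.algHom ℚ (σ := Fin N) (R := ℚ)).comp
        (MvPolynomial.symmetricSubalgebra (Fin N) ℚ).val).comp
          (MvPolynomial.esymmAlgHom (Fin N) ℚ N) := by
    ext i : 1
    simp [eHom, MvPolynomial.esymmAlgHom, restrict_e]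
  exact DFunLike.congr_fun this P

theorem eHom_injective : Function.Injective eHom := by
  rw [injective_iff_map_eq_zero]
  intro P hP
  obtain ⟨N, hN⟩ : ∃ N : ℕ, (P.vars : Set ℕ) ⊆ Set.range (Fin.val : Fin N → ℕ) := by
    refine ⟨P.vars.sup id + 1, fun i hi => ⟨⟨i, ?_⟩, rfl⟩⟩
    exact Nat.lt_succ_of_le (Finset.le_sup (f := id) hi)
  obtain ⟨Q, rfl⟩ := MvPolynomial.exists_rename_eq_of_vars_subset_range P Fin.val
    Fin.val_injective hN
  have h := restrict_eHom N Q
  rw [hP, map_zero] at h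
  have h2 : (MvPolynomial.esymmAlgHom (Fin N) ℚ N Q : MvPolynomial (Fin N) ℚ) = 0 :=
    MvPolynomial.coe_injective _ _ (by rw [← h, MvPolynomial.coe_zero])
  have h3 : MvPolynomial.esymmAlgHom (Fin N) ℚ N Q = 0 := Subtype.ext h2
  rw [(injective_iff_map_eq_zero _).1 (MvPolynomial.esymmAlgHom_fin_bijective ℚ N).1 Q h3, map_zero]

/-- Each monomial in the `e_i` is homogeneous. -/
theorem eHom_monomial_homogeneous (m : ℕ →₀ ℕ) (c : ℚ) : ∃ k : ℕ, ∀ a : ℕ →₀ ℕ,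
    coeff a (eHom (MvPolynomial.monomial m c) : MvPowerSeries ℕ ℚ) ≠ 0 → a.degree = k := by
  have hmul : ∀ f g : Sym,
      (∃ k : ℕ, ∀ a : ℕ →₀ ℕ, coeff a (f : MvPowerSeries ℕ ℚ) ≠ 0 → a.degree = k) →
      (∃ k : ℕ, ∀ a : ℕ →₀ ℕ, coeff a (g : MvPowerSeries ℕ ℚ) ≠ 0 → a.degree = k) →
      ∃ k : ℕ, ∀ a : ℕ →₀ ℕ, coeff a ((f * g : Sym) : MvPowerSeries ℕ ℚ) ≠ 0 → a.degree = k := by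
    rintro f g ⟨k, hk⟩ ⟨l, hl⟩
    refine ⟨k + l, fun a ha => ?_⟩
    rw [Subalgebra.coe_mul, coeff_mul] at ha
    obtain ⟨q, hq, hne⟩ := Finset.exists_ne_zero_of_sum_ne_zero ha
    rw [← Finset.HasAntidiagonal.mem_antidiagonal.1 hq, map_add, hk _ (left_ne_zero_of_mul hne),
      hl _ (right_ne_zero_of_mul hne)]
  have hconst : ∀ r : ℚ, ∃ k : ℕ, ∀ a : ℕ →₀ ℕ,
      coeff a ((algebraMap ℚ Sym r : Sym) : MvPowerSeries ℕ ℚ) ≠ 0 → a.degree = k := by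
    classical
    refine fun r => ⟨0, fun a ha => ?_⟩
    rw [Subalgebra.coe_algebraMap, MvPowerSeries.algebraMap_apply, coeff_C] at ha
    have : a = 0 := by
      by_contra hne
      exact ha (if_neg hne)
    rw [this, map_zero]
  have hone : ∃ k : ℕ, ∀ a : ℕ →₀ ℕ, coeff a ((1 : Sym) : MvPowerSeries ℕ ℚ) ≠ 0 → a.degree = k := by
    simpa using hconst 1
  rw [eHom, MvPolynomial.aeval_monomial]
  refine hmul _ _ (hconst c) ?_
  refine Finset.prod_induction _ (fun f : Sym => ∃ k : ℕ, ∀ a : ℕ →₀ ℕ,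
    coeff a (f : MvPowerSeries ℕ ℚ) ≠ 0 → a.degree = k) hmul hone fun i _ => ?_
  generalize m i = j
  induction j with
  | zero => simpa using hone
  | succ j ih =>
    simp only [pow_succ]
    refine hmul _ _ ih ⟨i + 1, fun a ha => ?_⟩
    by_contra hne
    exact ha (if_neg fun hh => hne hh.1)

/-- The range of `eHom` is stable under discarding the terms of degree more than `d`. -/
theorem exists_eHom_trunc (d : ℕ) (P : MvPolynomial ℕ ℚ) : ∃ P' : MvPolynomial ℕ ℚ,
    ∀ a : ℕ →₀ ℕ, coeff a (eHom P' : MvPowerSeries ℕ ℚ) =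
      if a.degree ≤ d then coeff a (eHom P : MvPowerSeries ℕ ℚ) else 0 := by
  induction P using MvPolynomial.induction_on' with
  | monomial m c =>
    obtain ⟨k, hk⟩ := eHom_monomial_homogeneous m c
    by_cases hkd : k ≤ d
    · refine ⟨MvPolynomial.monomial m c, fun a => ?_⟩
      split_ifs with ha
      · rfl
      · by_contra hne
        exact ha (hk a hne ▸ hkd)
    · refine ⟨0, fun a => ?_⟩
      rw [map_zero, ZeroMemClass.coe_zero, map_zero]
      split_ifs with ha
      · by_contra hne
        exact hkd (hk a (Ne.symm hne) ▸ ha)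
      · rfl
  | add P Q hP hQ =>
    obtain ⟨P', hP'⟩ := hP
    obtain ⟨Q', hQ'⟩ := hQ
    refine ⟨P' + Q', fun a => ?_⟩
    rw [map_add, map_add, Subalgebra.coe_add, Subalgebra.coe_add, map_add, map_add, hP', hQ']
    split_ifs <;> simp

/-- A symmetric function of degree at most `d` is determined by its restriction to `d` variables. -/
theorem eq_of_restrict_eq (d : ℕ) (f g : Sym)
    (hf : ∀ a : ℕ →₀ ℕ, d < a.degree → coeff a (f : MvPowerSeries ℕ ℚ) = 0)
    (hg : ∀ a : ℕ →₀ ℕ, d < a.degree → coeff a (g : MvPowerSeries ℕ ℚ) = 0)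
    (hfg : ∀ a : Fin d →₀ ℕ, a.degree ≤ d → coeff a (restrict d f) = coeff a (restrict d g)) :
    f = g := by
  refine Subtype.ext (MvPowerSeries.ext fun a => ?_)
  rcases lt_or_ge d a.degree with ha | ha
  · rw [hf a ha, hg a ha]
  have hcard : a.support.card ≤ d := by
    refine le_trans ?_ ha
    rw [Finsupp.degree_apply, Finset.card_eq_sum_ones]
    exact Finset.sum_le_sum fun i hi => Nat.one_le_iff_ne_zero.2 (Finsupp.mem_support_iff.1 hi)
  obtain ⟨w, hw⟩ : ∃ w : Equiv.Perm ℕ, ∀ i ∈ a.support, w i < d := by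
    have hle : Fintype.card a.support ≤ Fintype.card (Fin d) := by simpa using hcard
    obtain ⟨u⟩ := Function.Embedding.nonempty_of_card_le hle
    obtain ⟨w, hw⟩ := Equiv.Perm.exists_extending_pair
      (fun i : a.support => (i : ℕ)) (fun i => (u i : ℕ)) Subtype.val_injective
      (Fin.val_injective.comp u.injective)
    refine ⟨w, fun i hi => ?_⟩
    have := hw ⟨i, hi⟩
    simp only at this
    rw [this]
    exact (u ⟨i, hi⟩).2
  obtain ⟨b, hb⟩ : ∃ b : Fin d →₀ ℕ,
      b.embDomain Fin.valEmbedding = a.embDomain w.toEmbedding := by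
    refine ⟨(a.embDomain w.toEmbedding).comapDomain Fin.val Fin.val_injective.injOn, ?_⟩
    rw [Finsupp.embDomain_eq_mapDomain]
    refine Finsupp.mapDomain_comapDomain _ Fin.val_injective _ ?_
    intro j hj
    rw [Finsupp.support_embDomain, Finset.coe_map] at hj
    obtain ⟨i, hi, rfl⟩ := hj
    exact ⟨⟨w i, hw i hi⟩, rfl⟩
  have hdeg : b.degree ≤ d := by
    rw [← degree_embDomain Fin.valEmbedding b, hb, degree_embDomain]
    exact ha
  have := hfg b hdeg
  rwa [coeff_restrict, coeff_restrict, hb, f.2.1, g.2.1] at this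

theorem eHom_surjective : Function.Surjective eHom := by
  intro f
  obtain ⟨d, hd⟩ := f.2.2
  let q : MvPolynomial (Fin d) ℚ := truncTotal (d + 1) (restrict d f)
  have hqc : ∀ a : Fin d →₀ ℕ, a.degree ≤ d → q.coeff a = coeff a (restrict d f) :=
    fun a ha => coeff_truncTotal _ (Nat.lt_succ_of_le ha)
  have hq0 : ∀ a : Fin d →₀ ℕ, d < a.degree → q.coeff a = 0 :=
    fun a ha => coeff_truncTotal_eq_zero _ (Nat.succ_le_of_lt ha)
  have hq : q ∈ MvPolynomial.symmetricSubalgebra (Fin d) ℚ := by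
    intro w
    ext a
    obtain ⟨b, rfl⟩ : ∃ b : Fin d →₀ ℕ, a = b.mapDomain w :=
      ⟨a.mapDomain w.symm, by rw [← Finsupp.mapDomain_comp]; simp⟩
    rw [MvPolynomial.coeff_rename_mapDomain _ w.injective]
    have hdeg : (b.mapDomain w).degree = b.degree := by
      rw [← degree_embDomain w.toEmbedding b, Finsupp.embDomain_eq_mapDomain]
      rfl
    rcases lt_or_ge d b.degree with hb | hb
    · rw [hq0 _ hb, hq0 _ (by omega)]
    rw [hqc _ hb, hqc _ (by omega), coeff_restrict, coeff_restrict]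
    rw [← f.2.1 (w.extendDomain Fin.equivSubtype) (b.embDomain Fin.valEmbedding)]
    congr 2
    rw [Finsupp.embDomain_eq_mapDomain, Finsupp.embDomain_eq_mapDomain,
      Finsupp.embDomain_eq_mapDomain, ← Finsupp.mapDomain_comp, ← Finsupp.mapDomain_comp]
    congr 1
    funext i
    exact (Equiv.Perm.extendDomain_apply_image w Fin.equivSubtype i)
  obtain ⟨P, hP⟩ := (MvPolynomial.esymmAlgHom_fin_bijective ℚ d).2 ⟨q, hq⟩
  obtain ⟨P', hP'⟩ := exists_eHom_trunc d (MvPolynomial.rename Fin.val P)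
  refine ⟨P', eq_of_restrict_eq d _ _ (fun a ha => ?_) hd fun a ha => ?_⟩
  · rw [hP', if_neg (by omega)]
  · rw [coeff_restrict, hP', if_pos (by rwa [degree_embDomain]), ← coeff_restrict, restrict_eHom,
      hP, MvPolynomial.coeff_coe, hqc _ ha]

/-- The fundamental theorem of symmetric functions: `Λ_ℚ` is the polynomial algebra on
`e₁, e₂, …`. -/
noncomputable def eEquiv : MvPolynomial ℕ ℚ ≃ₐ[ℚ] Sym :=
  AlgEquiv.ofBijective eHom ⟨eHom_injective, eHom_surjective⟩

/-- The involution `ω` of `Λ_ℚ`: the unique algebra endomorphism with `ω(e_n) = h_n`, `n ≥ 1`. -/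
noncomputable def omega : Sym →ₐ[ℚ] Sym :=
  (MvPolynomial.aeval fun i => h (i + 1)).comp eEquiv.symm.toAlgHom

theorem omega_e (i : ℕ) : omega (e (i + 1)) = h (i + 1) := by
  have : eEquiv (MvPolynomial.X i) = e (i + 1) := by simp [eEquiv, eHom]
  rw [← this]
  simp [omega]

/-! ### Superfication and shiftification -/

/-- `f(x, y)`: the symmetric function `f` evaluated at the union of two countable sets of variables,
the `x`-variables being indexed by `Sum.inl` and the `y`-variables by `Sum.inr`. -/
noncomputable def double (f : Sym) : MvPowerSeries (ℕ ⊕ ℕ) ℚ :=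
  renameEquiv ℚ Equiv.natSumNatEquivNat.symm (f : MvPowerSeries ℕ ℚ)

theorem coeff_double (f : Sym) (c : ℕ ⊕ ℕ →₀ ℕ) : coeff c (double f) =
    coeff (c.embDomain Equiv.natSumNatEquivNat.toEmbedding) (f : MvPowerSeries ℕ ℚ) := by
  have hc : c = (c.embDomain Equiv.natSumNatEquivNat.toEmbedding).embDomain
      Equiv.natSumNatEquivNat.symm.toEmbedding := by
    rw [Finsupp.embDomain_eq_mapDomain, Finsupp.embDomain_eq_mapDomain, ← Finsupp.mapDomain_comp]
    conv_lhs => rw [← Finsupp.mapDomain_id (v := c)]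
    congr 1
    funext s
    exact (Equiv.natSumNatEquivNat.symm_apply_apply s).symm
  conv_lhs => rw [hc]
  exact coeff_embDomain_rename Equiv.natSumNatEquivNat.symm.toEmbedding _ _

/-- The coefficient of `x^a` in `f(x, y)`, which is a symmetric function of `y`. -/
noncomputable def coeffX (f : Sym) (a : ℕ →₀ ℕ) : Sym :=
  ⟨fun b => coeff (a.sumElim b) (double f), by
    refine ⟨fun w b => ?_, ?_⟩
    · change coeff (a.sumElim (b.embDomain w.toEmbedding)) (double f) =
        coeff (a.sumElim b) (double f)
      rw [coeff_double, coeff_double, ← f.2.1 ((Equiv.natSumNatEquivNat.symm.trans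
        (Equiv.sumCongr (Equiv.refl ℕ) w)).trans Equiv.natSumNatEquivNat)
          ((a.sumElim b).embDomain _)]
      congr 2
      ext j
      obtain ⟨s, rfl⟩ := Equiv.natSumNatEquivNat.surjective j
      have h1 : ∀ c : ℕ ⊕ ℕ →₀ ℕ, (c.embDomain Equiv.natSumNatEquivNat.toEmbedding)
          (Equiv.natSumNatEquivNat s) = c s := fun c =>
        Finsupp.embDomain_apply_self Equiv.natSumNatEquivNat.toEmbedding c s
      have h2 : ∀ (u : Equiv.Perm ℕ) (c : ℕ →₀ ℕ) (i : ℕ),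
          (c.embDomain u.toEmbedding) i = c (u.symm i) := by
        intro u c i
        conv_lhs => rw [← u.apply_symm_apply i]
        exact Finsupp.embDomain_apply_self u.toEmbedding c (u.symm i)
      rw [h1, h2]
      have h3 : ∀ t, (((a.sumElim b).embDomain Equiv.natSumNatEquivNat.toEmbedding)
          (Equiv.natSumNatEquivNat t)) = (a.sumElim b) t := fun t =>
        Finsupp.embDomain_apply_self Equiv.natSumNatEquivNat.toEmbedding _ t
      simp only [Equiv.symm_trans_apply, Equiv.symm_apply_apply, Equiv.symm_symm]
      rw [h3]
      rcases s with s | s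
      · rfl
      · exact h2 w b s
    · obtain ⟨d, hd⟩ := f.2.2
      refine ⟨d, fun b hb => ?_⟩
      change coeff (a.sumElim b) (double f) = 0
      rw [coeff_double]
      refine hd _ (lt_of_lt_of_le hb ?_)
      rw [degree_embDomain]
      have : a.sumElim b = a.embDomain Function.Embedding.inl +
          b.embDomain Function.Embedding.inr := by
        ext s
        rw [Finsupp.add_apply]
        rcases s with s | s
        · have h1 := Finsupp.embDomain_apply_self (Function.Embedding.inl : ℕ ↪ ℕ ⊕ ℕ) a s
          have h2 := Finsupp.embDomain_of_notMem_range (Function.Embedding.inr : ℕ ↪ ℕ ⊕ ℕ) b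
            (Sum.inl s) (by simp)
          rw [Function.Embedding.inl_apply] at h1
          rw [h1, h2]
          rfl
        · have h1 := Finsupp.embDomain_apply_self (Function.Embedding.inr : ℕ ↪ ℕ ⊕ ℕ) b s
          have h2 := Finsupp.embDomain_of_notMem_range (Function.Embedding.inl : ℕ ↪ ℕ ⊕ ℕ) a
            (Sum.inr s) (by simp)
          rw [Function.Embedding.inr_apply] at h1
          rw [h1, h2, zero_add]
          rfl
      rw [this, map_add, degree_embDomain, degree_embDomain]
      omega⟩

/-- The superfication `f(x/y) = ω_y f(x, y)`: apply `ω` in the `y`-variables to each coefficient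
of a monomial in the `x`-variables. -/
noncomputable def superfication (f : Sym) : MvPowerSeries (ℕ ⊕ ℕ) ℚ := fun c =>
  coeff (c.comapDomain Sum.inr Sum.inr_injective.injOn)
    (omega (coeffX f (c.comapDomain Sum.inl Sum.inl_injective.injOn)) : MvPowerSeries ℕ ℚ)

instance tendstoCofinite_codiagonal :
    Filter.TendstoCofinite (Sum.elim id id : ℕ ⊕ ℕ → ℕ) := by
  refine (Filter.tendstoCofinite_iff_finite_preimage_singleton _).2 fun b => ?_
  refine Set.Finite.subset (Set.toFinite {Sum.inl b, Sum.inr b}) ?_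
  rintro (s | s) hs
  · left
    exact congrArg Sum.inl hs
  · right
    exact congrArg Sum.inr hs

/-- The shiftification `f(x/x)`: set `y = x` in the superfication `f(x/y)`. -/
noncomputable def shiftification (f : Sym) : MvPowerSeries ℕ ℚ :=
  rename (Sum.elim id id : ℕ ⊕ ℕ → ℕ) (superfication f)

/-! ### The parking function symmetric function -/

/-- The increasing rearrangement of a sequence. -/
def rearrange {n : ℕ} (a : Fin n → ℕ) : Fin n → ℕ := a ∘ Tuple.sort a

/-- Parking functions of length `n`: sequences of positive integers whose increasing rearrangement
`b₁ ≤ ⋯ ≤ b_n` satisfies `b_i ≤ i` (the index `i : Fin n` starts at `0`). -/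
def ParkingFunction (n : ℕ) : Type :=
  {a : Fin n → ℕ // (∀ i, 1 ≤ a i) ∧ ∀ i : Fin n, rearrange a i ≤ (i : ℕ) + 1}

/-- The symmetric group acts on parking functions by permuting coordinates. -/
instance (n : ℕ) : MulAction (Equiv.Perm (Fin n)) (ParkingFunction n) where
  smul w a := ⟨fun i => a.1 (w⁻¹ i), fun i => a.2.1 _, by
    have : rearrange (a.1 ∘ ⇑w⁻¹) = rearrange a.1 := Tuple.comp_perm_comp_sort_eq_comp_sort
    exact this ▸ a.2.2⟩
  one_smul _ := rfl
  mul_smul _ _ _ := rfl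

instance (n : ℕ) : Finite (ParkingFunction n) := by
  refine Set.Finite.subset (Set.Finite.pi' fun _ : Fin n => Set.finite_Iic n) ?_
  rintro a ⟨-, ha⟩ i
  have := ha ((Tuple.sort a).symm i)
  have h2 := ((Tuple.sort a).symm i).2
  simp only [rearrange, Function.comp_apply, Equiv.apply_symm_apply] at this
  exact this.trans h2

/-- The Frobenius characteristic `(1/n!) ∑_w χ(w) p_{ρ(w)}` of a finite-dimensional representation
of the symmetric group with character `χ`, where `ρ(w)` is the cycle type of `w`
(fixed points included). -/
noncomputable def frobeniusChar {n : ℕ} {V : Type*} [AddCommGroup V] [Module ℚ V]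
    [FiniteDimensional ℚ V] (r : Representation ℚ (Equiv.Perm (Fin n)) V) : Sym :=
  ((n.factorial : ℚ)⁻¹) • ∑ w : Equiv.Perm (Fin n), r.character w • pPart w.partition

instance (n : ℕ) : FiniteDimensional ℚ (MonoidAlgebra ℚ (ParkingFunction n)) :=
  Module.Finite.equiv (MonoidAlgebra.coeffLinearEquiv ℚ).symm

/-- The parking function symmetric function `PF_n`: the Frobenius characteristic of the permutation
representation of the symmetric group on parking functions of length `n`. -/
noncomputable def PF (n : ℕ) : Sym :=
  frobeniusChar (Representation.ofMulAction ℚ (Equiv.Perm (Fin n)) (ParkingFunction n))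

/-- The shifted parking function symmetric function `SH_n(x) = PF_n(x/x)`. -/
noncomputable def SH (n : ℕ) : MvPowerSeries ℕ ℚ := shiftification (PF n)

/-! ### Partitions -/

/-- `z_λ = ∏_{i ≥ 1} i^{m_i} m_i!`, where `m_i` is the number of parts of `λ` equal to `i`. -/
def z {n : ℕ} (l : n.Partition) : ℕ :=
  ∏ i ∈ l.parts.toFinset, i ^ l.parts.count i * (l.parts.count i).factorial

end ShiftedParking

namespace ShiftedParking

open MvPowerSeries

/-! The theorem is the power sum expansion of `PF n` pushed through shiftification.

Shiftification is a `ℚ`-algebra homomorphism (`shiftHom`). Since p_k(x,y) = p_k(x) + p_k(y) and ω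
p_k = (-1)^(k-1) p_k (`omega_p`, from Newton's identities for e and h), it multiplies p_k by 1 +
(-1)^(k-1): odd power sums are doubled and even ones die. Hence p_λ goes to 2^ℓ(λ) p_λ when all
parts are odd and to 0 otherwise (`shiftHom_pPart`).

For `PF n`, the character at w counts the parking functions fixed by w. By Pollak's argument
(`existsUnique_isParking_sub`) every map to ℤ/(n+1) has exactly one cyclic shift that is parking.
Shifting values commutes with permuting coordinates, so the w-invariant maps are n+1 times as
numerous as the w-invariant parking functions. An invariant map is constant on cycles, so there are
(n+1)^ℓ(λ) of them for w of cycle type λ, and the character is (n+1)^(ℓ(λ)-1). Grouping permutations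
by cycle type, with n!/z_λ in each class, gives `PF_eq_sum`. -/

/-! ### Shiftification as an algebra homomorphism -/

theorem sum_antidiagonal_sumElim {M : Type*} [AddCommMonoid M] (a b : ℕ →₀ ℕ)
    (F : (ℕ ⊕ ℕ →₀ ℕ) → (ℕ ⊕ ℕ →₀ ℕ) → M) :
    ∑ q ∈ Finset.HasAntidiagonal.antidiagonal (a.sumElim b), F q.1 q.2 =
      ∑ u ∈ Finset.HasAntidiagonal.antidiagonal a, ∑ v ∈ Finset.HasAntidiagonal.antidiagonal b,
        F (u.1.sumElim v.1) (u.2.sumElim v.2) := by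
  rw [← Finsupp.image_sumElim_product_antidiagonal, Finset.sum_image, Finset.sum_product]
  rintro ⟨⟨u₁, u₂⟩, v₁, v₂⟩ _ ⟨⟨u₃, u₄⟩, v₃, v₄⟩ _ huv
  simp only [Prod.mk.injEq] at huv ⊢
  have h1 := congrArg (Finsupp.comapDomain Sum.inl · Sum.inl_injective.injOn) huv.1
  have h2 := congrArg (Finsupp.comapDomain Sum.inl · Sum.inl_injective.injOn) huv.2
  have h3 := congrArg (Finsupp.comapDomain Sum.inr · Sum.inr_injective.injOn) huv.1
  have h4 := congrArg (Finsupp.comapDomain Sum.inr · Sum.inr_injective.injOn) huv.2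
  simp only [Finsupp.comapDomain_inl_sumElim, Finsupp.comapDomain_inr_sumElim] at h1 h2 h3 h4
  exact ⟨⟨h1, h2⟩, h3, h4⟩

theorem coeff_coeffX (f : Sym) (a b : ℕ →₀ ℕ) :
    coeff b (coeffX f a : MvPowerSeries ℕ ℚ) = coeff (a.sumElim b) (double f) := rfl

theorem coeff_superfication (f : Sym) (a b : ℕ →₀ ℕ) :
    coeff (a.sumElim b) (superfication f) =
      coeff b (omega (coeffX f a) : MvPowerSeries ℕ ℚ) := by
  change coeff ((a.sumElim b).comapDomain Sum.inr Sum.inr_injective.injOn)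
    (omega (coeffX f ((a.sumElim b).comapDomain Sum.inl Sum.inl_injective.injOn)) :
      MvPowerSeries ℕ ℚ) = _
  rw [Finsupp.comapDomain_inl_sumElim, Finsupp.comapDomain_inr_sumElim]

theorem coeff_sum_coe {ι : Type*} (s : Finset ι) (F : ι → Sym) (b : ℕ →₀ ℕ) :
    coeff b ((∑ i ∈ s, F i : Sym) : MvPowerSeries ℕ ℚ) =
      ∑ i ∈ s, coeff b (F i : MvPowerSeries ℕ ℚ) := by
  rw [AddSubmonoidClass.coe_finsetSum, map_sum]

theorem double_mul (f g : Sym) : double (f * g) = double f * double g :=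
  map_mul (renameEquiv ℚ Equiv.natSumNatEquivNat.symm) (f : MvPowerSeries ℕ ℚ) g

theorem double_add (f g : Sym) : double (f + g) = double f + double g :=
  map_add (renameEquiv ℚ Equiv.natSumNatEquivNat.symm) (f : MvPowerSeries ℕ ℚ) g

theorem double_smul (r : ℚ) (f : Sym) : double (r • f) = r • double f :=
  map_smul (renameEquiv ℚ Equiv.natSumNatEquivNat.symm) r (f : MvPowerSeries ℕ ℚ)

theorem double_one : double 1 = 1 :=
  map_one (renameEquiv ℚ Equiv.natSumNatEquivNat.symm)

theorem coeffX_mul (f g : Sym) (a : ℕ →₀ ℕ) :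
    coeffX (f * g) a = ∑ u ∈ Finset.HasAntidiagonal.antidiagonal a, coeffX f u.1 * coeffX g u.2 := by
  refine Subtype.ext (MvPowerSeries.ext fun b => ?_)
  rw [coeff_coeffX, double_mul, coeff_mul, coeff_sum_coe,
    sum_antidiagonal_sumElim a b fun s t => coeff s (double f) * coeff t (double g)]
  refine Finset.sum_congr rfl fun u _ => ?_
  rw [Subalgebra.coe_mul, coeff_mul]
  rfl

theorem coeffX_add (f g : Sym) (a : ℕ →₀ ℕ) : coeffX (f + g) a = coeffX f a + coeffX g a := by
  refine Subtype.ext (MvPowerSeries.ext fun b => ?_)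
  rw [coeff_coeffX, double_add, Subalgebra.coe_add, map_add, map_add]
  rfl

theorem coeffX_smul (r : ℚ) (f : Sym) (a : ℕ →₀ ℕ) : coeffX (r • f) a = r • coeffX f a := by
  refine Subtype.ext (MvPowerSeries.ext fun b => ?_)
  rw [coeff_coeffX, double_smul, Subalgebra.coe_smul, map_smul, map_smul]
  rfl

theorem sumElim_eq_zero_iff (a b : ℕ →₀ ℕ) : a.sumElim b = 0 ↔ a = 0 ∧ b = 0 := by
  refine ⟨fun hab => ?_, ?_⟩
  · have h1 := congrArg (Finsupp.comapDomain Sum.inl · Sum.inl_injective.injOn) hab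
    have h2 := congrArg (Finsupp.comapDomain Sum.inr · Sum.inr_injective.injOn) hab
    simpa using And.intro h1 h2
  · rintro ⟨rfl, rfl⟩
    simp

theorem coeffX_one (a : ℕ →₀ ℕ) : coeffX 1 a = if a = 0 then 1 else 0 := by
  refine Subtype.ext (MvPowerSeries.ext fun b => ?_)
  rw [coeff_coeffX, double_one, coeff_one]
  by_cases ha : a = 0 <;> simp [ha, sumElim_eq_zero_iff, coeff_one]

theorem superfication_ext {F G : MvPowerSeries (ℕ ⊕ ℕ) ℚ}
    (hFG : ∀ a b : ℕ →₀ ℕ, coeff (a.sumElim b) F = coeff (a.sumElim b) G) : F = G := by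
  refine MvPowerSeries.ext fun c => ?_
  rw [← Finsupp.comapDomain_sumElim_comapDomain c]
  exact hFG _ _

/-- The x-coefficients of a product are Cauchy sums of products of x-coefficients (`coeffX_mul`),
and ω, applied to each coefficient, respects sums and products. -/
theorem superfication_mul (f g : Sym) :
    superfication (f * g) = superfication f * superfication g := by
  refine superfication_ext fun a b => ?_
  rw [coeff_superfication, coeffX_mul, map_sum, coeff_sum_coe, coeff_mul,
    sum_antidiagonal_sumElim a b fun s t => coeff s (superfication f) * coeff t (superfication g)]
  refine Finset.sum_congr rfl fun u _ => ?_
  rw [map_mul, Subalgebra.coe_mul, coeff_mul]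
  exact Finset.sum_congr rfl fun v _ => by rw [coeff_superfication, coeff_superfication]

theorem superfication_add (f g : Sym) :
    superfication (f + g) = superfication f + superfication g := by
  refine superfication_ext fun a b => ?_
  rw [map_add, coeff_superfication, coeff_superfication, coeff_superfication, coeffX_add, map_add,
    Subalgebra.coe_add, map_add]

theorem superfication_smul (r : ℚ) (f : Sym) :
    superfication (r • f) = r • superfication f := by
  refine superfication_ext fun a b => ?_
  rw [map_smul, coeff_superfication, coeff_superfication, coeffX_smul, map_smul,
    Subalgebra.coe_smul, map_smul]

theorem superfication_one : superfication 1 = 1 := by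
  refine superfication_ext fun a b => ?_
  rw [coeff_superfication, coeffX_one, coeff_one]
  by_cases ha : a = 0 <;> simp [ha, sumElim_eq_zero_iff, coeff_one]

/-- Shiftification as an algebra homomorphism. -/
noncomputable def shiftHom : Sym →ₐ[ℚ] MvPowerSeries ℕ ℚ :=
  (rename (Sum.elim id id : ℕ ⊕ ℕ → ℕ)).comp
    (AlgHom.ofLinearMap
      { toFun := superfication
        map_add' := superfication_add
        map_smul' := superfication_smul } superfication_one superfication_mul)

theorem shiftHom_apply (f : Sym) : shiftHom f = shiftification f := rfl

/-! ### Newton's identities for e and h -/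

open Classical in
theorem coeff_e (k : ℕ) (a : ℕ →₀ ℕ) : coeff a (e k : MvPowerSeries ℕ ℚ) =
    if a.degree = k ∧ ∀ i, a i ≤ 1 then 1 else 0 := rfl

theorem coeff_h (k : ℕ) (a : ℕ →₀ ℕ) : coeff a (h k : MvPowerSeries ℕ ℚ) =
    if a.degree = k then 1 else 0 := by
  change (if a.degree = k then (1 : ℚ) else 0) = _
  congr

open Classical in
theorem coeff_p (k : ℕ) (a : ℕ →₀ ℕ) : coeff a (p k : MvPowerSeries ℕ ℚ) =
    if ∃ i, a = Finsupp.single i k then 1 else 0 := rfl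

theorem e_zero : e 0 = 1 := by
  classical
  refine Subtype.ext (MvPowerSeries.ext fun a => ?_)
  rw [coeff_e, Subalgebra.coe_one, coeff_one]
  refine if_congr ⟨fun ha => (Finsupp.degree_eq_zero_iff a).1 ha.1, ?_⟩ rfl rfl
  rintro rfl
  simp

theorem h_zero : h 0 = 1 := by
  refine Subtype.ext (MvPowerSeries.ext fun a => ?_)
  rw [coeff_h, Subalgebra.coe_one, coeff_one]
  exact if_congr (Finsupp.degree_eq_zero_iff a) rfl rfl

/-- Each exponent has finite support, so each coefficient is already seen in finitely many
variables. This transfers identities between symmetric polynomials to `Sym`. -/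
theorem ext_of_restrict {f g : Sym} (hfg : ∀ N, restrict N f = restrict N g) : f = g := by
  refine Subtype.ext (MvPowerSeries.ext fun a => ?_)
  obtain ⟨b, hb⟩ : ∃ b : Fin (a.support.sup id + 1) →₀ ℕ,
      b.embDomain Fin.valEmbedding = a := by
    refine ⟨a.comapDomain Fin.val Fin.val_injective.injOn, ?_⟩
    rw [Finsupp.embDomain_eq_mapDomain]
    exact Finsupp.mapDomain_comapDomain _ Fin.val_injective _ fun j hj =>
      ⟨⟨j, Nat.lt_succ_of_le (Finset.le_sup (f := id) hj)⟩, rfl⟩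
  rw [← hb, ← coeff_restrict, hfg, coeff_restrict]

theorem restrict_p (N k : ℕ) :
    restrict N (p (k + 1)) = (MvPolynomial.psum (Fin N) ℚ (k + 1) : MvPowerSeries (Fin N) ℚ) := by
  classical
  ext a
  rw [coeff_restrict, coeff_p, MvPolynomial.coeff_coe, MvPolynomial.psum, MvPolynomial.coeff_sum]
  simp only [MvPolynomial.coeff_X_pow]
  split_ifs with ha
  · obtain ⟨i, hi⟩ := ha
    have hiN : i ∈ (a.embDomain Fin.valEmbedding).support := by simp [hi]
    rw [Finsupp.support_embDomain, Finset.mem_map] at hiN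
    obtain ⟨j, -, rfl⟩ := hiN
    have haj : Finsupp.single j (k + 1) = a := by
      refine Finsupp.embDomain_injective Fin.valEmbedding ?_
      rw [hi, Finsupp.embDomain_single]
    rw [Finset.sum_eq_single j, if_pos haj]
    · intro l _ hl
      refine if_neg fun hla => hl ?_
      exact (Finsupp.single_left_inj (Nat.succ_ne_zero k)).1 (hla.trans haj.symm)
    · exact fun hn => (hn (Finset.mem_univ _)).elim
  · symm
    refine Finset.sum_eq_zero fun j _ => if_neg fun hj => ha ⟨j, ?_⟩
    rw [← hj, Finsupp.embDomain_single]
    rfl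

theorem newton_e (k : ℕ) : ((k + 1 : ℕ) : Sym) * e (k + 1) =
    ∑ j ∈ Finset.range (k + 1), (-1) ^ j * e (k - j) * p (j + 1) := by
  classical
  refine ext_of_restrict fun N => ?_
  have key := congrArg (MvPolynomial.coeToMvPowerSeries.ringHom (σ := Fin N) (R := ℚ))
    (MvPolynomial.mul_esymm_eq_sum (Fin N) ℚ (k + 1))
  have hre : ∀ i, MvPolynomial.coeToMvPowerSeries.ringHom (MvPolynomial.esymm (Fin N) ℚ i) =
      restrict N (e i) := fun i => by
    rw [restrict_e]
    rfl
  simp only [map_mul, map_natCast, map_sum, map_pow, map_neg, map_one, hre] at key ⊢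
  rw [key, Finset.mul_sum]
  symm
  refine Finset.sum_nbij' (fun j => (k - j, j + 1)) (fun x => x.2 - 1) ?_ ?_ ?_ ?_ ?_
  · intro j hj
    simp only [Finset.mem_range, Finset.mem_filter,
      Finset.HasAntidiagonal.mem_antidiagonal] at hj ⊢
    omega
  · rintro ⟨x, y⟩ hx
    simp only [Finset.mem_range, Finset.mem_filter,
      Finset.HasAntidiagonal.mem_antidiagonal] at hx ⊢
    omega
  · intro j hj
    simp
  · rintro ⟨x, y⟩ hx
    simp only [Finset.mem_filter, Finset.HasAntidiagonal.mem_antidiagonal] at hx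
    simp only [Prod.mk.injEq]
    omega
  · intro j hj
    rw [Finset.mem_range] at hj
    obtain ⟨i, rfl⟩ : ∃ i, k = j + i := ⟨k - j, by omega⟩
    -- With i = k - j, the polynomial identity carries the sign (-1)^(k+2) (-1)^i, whose exponent is
    -- j + 2(i+1); only (-1)^j survives.
    rw [restrict_p, Nat.add_sub_cancel_left, ← mul_assoc, ← mul_assoc, ← pow_add,
      show j + i + 1 + 1 + i = j + 2 * (i + 1) by ring, pow_add, pow_mul]
    simp

/-- The monomials of p_{j+1} are pure powers of one variable s, and such a power divides x^a exactly
when j < a s. -/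
theorem coeff_mul_p (f : Sym) (j : ℕ) (a : ℕ →₀ ℕ) :
    coeff a ((f * p (j + 1) : Sym) : MvPowerSeries ℕ ℚ) = ∑ s ∈ a.support,
      if j < a s then coeff (a - Finsupp.single s (j + 1)) (f : MvPowerSeries ℕ ℚ) else 0 := by
  classical
  rw [Subalgebra.coe_mul, coeff_mul]
  simp only [coeff_p, mul_ite, mul_one, mul_zero]
  rw [← Finset.sum_filter, ← Finset.sum_filter]
  symm
  refine Finset.sum_bij (fun s _ => (a - Finsupp.single s (j + 1), Finsupp.single s (j + 1)))
    ?_ ?_ ?_ ?_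
  · intro s hs
    rw [Finset.mem_filter] at hs
    rw [Finset.mem_filter, Finset.HasAntidiagonal.mem_antidiagonal]
    refine ⟨tsub_add_cancel_of_le ?_, s, rfl⟩
    rw [Finsupp.single_le_iff]
    exact hs.2
  · intro s _ t _ hst
    exact (Finsupp.single_left_inj (Nat.succ_ne_zero j)).1 (Prod.mk.inj hst).2
  · rintro ⟨u, v⟩ huv
    rw [Finset.mem_filter, Finset.HasAntidiagonal.mem_antidiagonal] at huv
    obtain ⟨huv, s, hs⟩ := huv
    simp only at huv hs
    have hlt : j < a s := by
      rw [← huv, hs]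
      simp
      omega
    refine ⟨s, ?_, ?_⟩
    · rw [Finset.mem_filter, Finsupp.mem_support_iff]
      exact ⟨by omega, hlt⟩
    · rw [← huv, hs, add_tsub_cancel_right]
  · intros
    rfl

/-- Compare coefficients of x^a with a of degree k+1. On the right, each variable s contributes one
for each j < a s, hence a s in all, and these exponents add up to k+1. -/
theorem newton_h (k : ℕ) : ((k + 1 : ℕ) : Sym) * h (k + 1) =
    ∑ j ∈ Finset.range (k + 1), h (k - j) * p (j + 1) := by
  refine Subtype.ext (MvPowerSeries.ext fun a => ?_)
  rw [coeff_sum_coe]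
  simp only [coeff_mul_p, coeff_h]
  rw [Finset.sum_comm, ← nsmul_eq_mul, Subalgebra.coe_smul, map_nsmul, coeff_h]
  have hterm : ∀ s ∈ a.support, ∑ j ∈ Finset.range (k + 1), (if j < a s then
      if (a - Finsupp.single s (j + 1)).degree = k - j then (1 : ℚ) else 0 else 0) =
      if a.degree = k + 1 then (a s : ℚ) else 0 := by
    intro s _
    have hdeg : ∀ j, j < a s → (a - Finsupp.single s (j + 1)).degree + (j + 1) = a.degree := by
      intro j hj
      have hle : Finsupp.single s (j + 1) ≤ a := by
        rw [Finsupp.single_le_iff]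
        exact hj
      rw [← congrArg Finsupp.degree (tsub_add_cancel_of_le hle), map_add, Finsupp.degree_single]
    split_ifs with ha
    · have hle : a s ≤ k + 1 := ha ▸ Finsupp.le_degree s a
      rw [← Finset.sum_filter]
      rw [Finset.sum_congr (g := fun _ => (1 : ℚ)) rfl, Finset.sum_const, nsmul_one]
      · congr 1
        rw [show Finset.filter (fun j => j < a s) (Finset.range (k + 1)) = Finset.range (a s) by
          ext j
          simp only [Finset.mem_filter, Finset.mem_range]
          omega, Finset.card_range]
      · intro j hj
        rw [Finset.mem_filter, Finset.mem_range] at hj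
        have := hdeg j hj.2
        exact if_pos (by omega)
    · refine Finset.sum_eq_zero fun j hj => ?_
      rw [Finset.mem_range] at hj
      split_ifs with h1 h2
      · have := hdeg j h1
        omega
      · rfl
      · rfl
  rw [Finset.sum_congr rfl hterm]
  split_ifs with ha
  · rw [← Nat.cast_sum, ← Finsupp.degree_apply, ha]
    simp
  · simp

/-! ### The images of power sums under ω and shiftification -/

theorem omega_e' (i : ℕ) : omega (e i) = h i := by
  cases i with
  | zero => rw [e_zero, h_zero, map_one]
  | succ i => exact omega_e i

theorem neg_one_pow_mul_self {R : Type*} [CommRing R] (k : ℕ) : (-1 : R) ^ k * (-1) ^ k = 1 := by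
  rw [← mul_pow, neg_mul_neg, one_mul, one_pow]

/-- Apply ω to `newton_e` and compare with `newton_h`. By induction the terms with j < k agree, the
two signs cancelling, which leaves (-1)^k ω(p_{k+1}) = p_{k+1}. -/
theorem omega_p (k : ℕ) : omega (p (k + 1)) = (-1) ^ k * p (k + 1) := by
  induction k using Nat.strong_induction_on with
  | _ k ih =>
    have h1 := congrArg omega (newton_e k)
    simp only [map_mul, map_natCast, map_sum, map_pow, map_neg, map_one, omega_e'] at h1
    rw [newton_h, Finset.sum_range_succ, Finset.sum_range_succ, Nat.sub_self, h_zero, one_mul,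
      mul_one] at h1
    have h2 : ∑ j ∈ Finset.range k, ((-1) ^ j * h (k - j)) * omega (p (j + 1)) =
        ∑ j ∈ Finset.range k, h (k - j) * p (j + 1) := by
      refine Finset.sum_congr rfl fun j hj => ?_
      rw [ih j (Finset.mem_range.1 hj), mul_comm _ (h (k - j)), mul_assoc, ← mul_assoc _ _ (p _),
        neg_one_pow_mul_self, one_mul]
    rw [h2] at h1
    have h3 := congrArg ((-1) ^ k * ·) (add_left_cancel h1)
    simp only [← mul_assoc, neg_one_pow_mul_self, one_mul] at h3
    exact h3.symm

/-- This is p_{k+1}(x,y) = p_{k+1}(y) + p_{k+1}(x) read off at x^a: the y-part occurs only at a = 0,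
and the x-part is constant in y. -/
theorem coeffX_p (k : ℕ) (a : ℕ →₀ ℕ) : coeffX (p (k + 1)) a =
    (if a = 0 then p (k + 1) else 0) + algebraMap ℚ Sym (coeff a (p (k + 1) : MvPowerSeries ℕ ℚ)) := by
  classical
  refine Subtype.ext (MvPowerSeries.ext fun b => ?_)
  have hp : coeff b (coeffX (p (k + 1)) a : MvPowerSeries ℕ ℚ) =
      if ∃ s, a.sumElim b = Finsupp.single s (k + 1) then 1 else 0 := by
    rw [coeff_coeffX, coeff_double, coeff_p]
    refine if_congr ⟨?_, ?_⟩ rfl rfl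
    · rintro ⟨i, hi⟩
      refine ⟨Equiv.natSumNatEquivNat.symm i,
        Finsupp.embDomain_injective Equiv.natSumNatEquivNat.toEmbedding ?_⟩
      rw [hi, Finsupp.embDomain_single]
      exact congrArg (Finsupp.single · (k + 1)) (Equiv.apply_symm_apply _ i).symm
    · rintro ⟨s, hs⟩
      exact ⟨Equiv.natSumNatEquivNat s, by rw [hs, Finsupp.embDomain_single]; rfl⟩
  have hinl : ∀ i, a.sumElim b = Finsupp.single (Sum.inl i) (k + 1) ↔
      a = Finsupp.single i (k + 1) ∧ b = 0 := by
    intro i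
    rw [← Finsupp.sumElim_single_zero]
    exact Finsupp.sumFinsuppEquivProdFinsupp.symm.injective.eq_iff
      (a := (a, b)) (b := (Finsupp.single i (k + 1), 0)) |>.trans Prod.mk_inj
  have hinr : ∀ i, a.sumElim b = Finsupp.single (Sum.inr i) (k + 1) ↔
      a = 0 ∧ b = Finsupp.single i (k + 1) := by
    intro i
    rw [← Finsupp.sumElim_zero_single]
    exact Finsupp.sumFinsuppEquivProdFinsupp.symm.injective.eq_iff
      (a := (a, b)) (b := (0, Finsupp.single i (k + 1))) |>.trans Prod.mk_inj
  rw [hp, Sum.exists]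
  simp only [hinl, hinr]
  rw [Subalgebra.coe_add, map_add, Subalgebra.coe_algebraMap, MvPowerSeries.algebraMap_apply,
    coeff_C, coeff_p]
  have hne : ∀ i, (0 : ℕ →₀ ℕ) ≠ Finsupp.single i (k + 1) := fun i h0 =>
    absurd (Finsupp.single_eq_zero.1 h0.symm) (Nat.succ_ne_zero k)
  by_cases ha : a = 0
  · subst ha
    simp [hne, coeff_p, -Finsupp.single_add]
  · by_cases hb : b = 0 <;> simp [ha, hb, -Finsupp.single_add]

theorem coeff_rename_inl (F : MvPowerSeries ℕ ℚ) (a b : ℕ →₀ ℕ) :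
    coeff (a.sumElim b) (rename (Function.Embedding.inl : ℕ ↪ ℕ ⊕ ℕ) F) =
      if b = 0 then coeff a F else 0 := by
  split_ifs with hb
  · rw [hb, ← Finsupp.embDomain_inl, coeff_embDomain_rename]
  · refine coeff_rename_eq_zero _ _ ?_
    rintro ⟨u, hu⟩
    refine hb ?_
    have := congrArg (Finsupp.comapDomain Sum.inr · Sum.inr_injective.injOn)
      ((Finsupp.embDomain_eq_mapDomain Function.Embedding.inl u).trans hu)
    simpa [Finsupp.embDomain_inl] using this.symm

theorem coeff_rename_inr (F : MvPowerSeries ℕ ℚ) (a b : ℕ →₀ ℕ) :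
    coeff (a.sumElim b) (rename (Function.Embedding.inr : ℕ ↪ ℕ ⊕ ℕ) F) =
      if a = 0 then coeff b F else 0 := by
  split_ifs with ha
  · rw [ha, ← Finsupp.embDomain_inr, coeff_embDomain_rename]
  · refine coeff_rename_eq_zero _ _ ?_
    rintro ⟨u, hu⟩
    refine ha ?_
    have := congrArg (Finsupp.comapDomain Sum.inl · Sum.inl_injective.injOn)
      ((Finsupp.embDomain_eq_mapDomain Function.Embedding.inr u).trans hu)
    simpa [Finsupp.embDomain_inr] using this.symm

theorem superfication_p (k : ℕ) : superfication (p (k + 1)) =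
    rename (Function.Embedding.inl : ℕ ↪ ℕ ⊕ ℕ) (p (k + 1) : MvPowerSeries ℕ ℚ) +
      (-1 : ℚ) ^ k •
        rename (Function.Embedding.inr : ℕ ↪ ℕ ⊕ ℕ) (p (k + 1) : MvPowerSeries ℕ ℚ) := by
  classical
  refine superfication_ext fun a b => ?_
  have homega : omega (p (k + 1)) = (-1 : ℚ) ^ k • p (k + 1) := by
    rw [omega_p, Algebra.smul_def, map_pow, map_neg, map_one]
  rw [coeff_superfication, coeffX_p, map_add, AlgHom.commutes, map_add, map_smul,
    coeff_rename_inl, coeff_rename_inr, Subalgebra.coe_add, map_add, Subalgebra.coe_algebraMap,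
    MvPowerSeries.algebraMap_apply, coeff_C, add_comm]
  congr 1
  split_ifs
  · rw [homega, Subalgebra.coe_smul, map_smul]
  · simp

theorem rename_codiagonal {i : ℕ ↪ ℕ ⊕ ℕ} (hi : Sum.elim id id ∘ i = id)
    (F : MvPowerSeries ℕ ℚ) : rename (Sum.elim id id : ℕ ⊕ ℕ → ℕ) (rename i F) = F := by
  rw [rename_rename]
  -- `rename` takes an instance depending on the function, so the equality with `id` is substituted
  -- for a general `g`.
  have : ∀ (g : ℕ → ℕ) [Filter.TendstoCofinite g], g = id → rename g F = F := by
    rintro g _ rfl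
    exact rename_id_apply F
  exact this _ hi

theorem shiftHom_p (k : ℕ) :
    shiftHom (p (k + 1)) = (1 + (-1 : ℚ) ^ k) • (p (k + 1) : MvPowerSeries ℕ ℚ) := by
  rw [shiftHom_apply, shiftification, superfication_p, map_add, map_smul,
    rename_codiagonal rfl, rename_codiagonal rfl, add_smul, one_smul]

/-- Stated for multisets because the induction removes one part at a time, which changes the number
being partitioned. -/
theorem shiftHom_prod_p (m : Multiset ℕ) (hm : ∀ k ∈ m, 0 < k) : shiftHom (m.map p).prod =
    (if ∀ k ∈ m, ¬ Even k then (2 : ℚ) ^ m.card else 0) •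
      ((m.map p).prod : MvPowerSeries ℕ ℚ) := by
  classical
  induction m using Multiset.induction_on with
  | empty => simp
  | cons k m ih =>
    obtain ⟨k, rfl⟩ := Nat.exists_eq_succ_of_ne_zero (hm k (Multiset.mem_cons_self k m)).ne'
    rw [Multiset.map_cons, Multiset.prod_cons, map_mul,
      ih fun j hj => hm j (Multiset.mem_cons_of_mem hj), Nat.succ_eq_add_one, shiftHom_p,
      smul_mul_smul_comm, Subalgebra.coe_mul]
    congr 1
    simp only [Multiset.card_cons, Multiset.forall_mem_cons]
    by_cases hk : Even k
    · rw [hk.neg_one_pow, mul_ite, mul_zero]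
      refine if_congr (and_iff_right (by simpa [Nat.even_add_one] using hk)).symm ?_ rfl
      ring
    · rw [(Nat.not_even_iff_odd.1 hk).neg_one_pow]
      simp [Nat.even_add_one, hk]

theorem shiftHom_pPart {n : ℕ} (l : n.Partition) : shiftHom (pPart l) =
    (if ∀ k ∈ l.parts, ¬ Even k then (2 : ℚ) ^ l.parts.card else 0) •
      (pPart l : MvPowerSeries ℕ ℚ) :=
  shiftHom_prod_p l.parts fun _ hk => l.parts_pos hk

/-! ### Pollak's cyclic shift argument -/

/-- A function to `{0, …, n}` lands, after adding `1`, in the parking functions. -/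
def IsParking {n : ℕ} (g : Fin n → Fin (n + 1)) : Prop :=
  ∀ k ≤ n, k ≤ (Finset.univ.filter fun i => (g i : ℕ) < k).card

theorem val_sub_lt_iff {n : ℕ} (x s : Fin (n + 1)) (k : ℕ) :
    ((x - s : Fin (n + 1)) : ℕ) < k ↔
      ((s : ℕ) ≤ x ∧ (x : ℕ) < s + k) ∨ (x : ℕ) + (n + 1) < s + k := by
  have hx := x.2
  have hs := s.2
  rcases le_or_gt s x with h1 | h1
  · rw [Fin.sub_val_of_le h1]
    rw [Fin.le_def] at h1
    omega
  · rw [Fin.lt_def] at h1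
    rw [Fin.val_sub, Nat.mod_eq_of_lt (by omega)]
    omega

/-- The number of values less than `m`. -/
def countLT {n : ℕ} (g : Fin n → Fin (n + 1)) (m : ℕ) : ℕ :=
  (Finset.univ.filter fun i => (g i : ℕ) < m).card

theorem countLT_top {n : ℕ} (g : Fin n → Fin (n + 1)) {m : ℕ} (hm : n < m) : countLT g m = n := by
  rw [countLT, Finset.filter_true_of_mem fun i _ => by have := (g i).2; omega, Finset.card_univ,
    Fintype.card_fin]

theorem card_between {n : ℕ} (g : Fin n → Fin (n + 1)) (s t : ℕ) (hst : s ≤ t) :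
    (Finset.univ.filter fun i => s ≤ (g i : ℕ) ∧ (g i : ℕ) < t).card + countLT g s =
      countLT g t := by
  rw [countLT, countLT, ← Finset.card_union_of_disjoint]
  · congr 1
    ext i
    simp only [Finset.mem_union, Finset.mem_filter, Finset.mem_univ, true_and]
    omega
  · rw [Finset.disjoint_left]
    intro i
    simp only [Finset.mem_filter, Finset.mem_univ, true_and]
    omega

/-- After the shift, the values below k come from the cyclic interval of length k starting at s. Its
wrapped part lies below s + k - (n+1); truncated subtraction makes that part empty when nothing
wraps. -/
theorem countLT_sub {n : ℕ} (g : Fin n → Fin (n + 1)) (s : Fin (n + 1)) (k : ℕ) (hk : k ≤ n) :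
    countLT (fun i => g i - s) k + countLT g s =
      countLT g (s + k) + countLT g (s + k - (n + 1)) := by
  have hs := s.2
  rw [← card_between g s (s + k) (by omega), countLT]
  rw [show (Finset.univ.filter fun i => ((g i - s : Fin (n + 1)) : ℕ) < k) =
    (Finset.univ.filter fun i => (s : ℕ) ≤ (g i : ℕ) ∧ (g i : ℕ) < s + k) ∪
      (Finset.univ.filter fun i => (g i : ℕ) < s + k - (n + 1)) by
    ext i
    simp only [Finset.mem_union, Finset.mem_filter, Finset.mem_univ, true_and]
    rw [val_sub_lt_iff]
    omega]
  rw [Finset.card_union_of_disjoint]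
  · simp only [countLT]
    omega
  · rw [Finset.disjoint_left]
    intro i
    simp only [Finset.mem_filter, Finset.mem_univ, true_and]
    omega

/-- Put S(t) = `countLT g t` - t. The parking condition compares S(s) with S along one turn starting
at s. Passing n lowers S by 1 (n values gained, n+1 steps made), so the comparison becomes strict
for t < s. The good shift is thus the first minimiser of S. -/
theorem isParking_sub_iff {n : ℕ} (g : Fin n → Fin (n + 1)) (s : Fin (n + 1)) :
    IsParking (fun i => g i - s) ↔ ∀ t : Fin (n + 1),
      (s ≤ t → (countLT g s : ℤ) - s ≤ countLT g t - t) ∧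
      (t < s → (countLT g s : ℤ) - s < countLT g t - t) := by
  have hs := s.2
  constructor
  · intro hp t
    have ht := t.2
    refine ⟨fun hst => ?_, fun hts => ?_⟩
    · rw [Fin.le_def] at hst
      have h1 := hp (t - s) (by omega)
      have h2 := countLT_sub g s (t - s) (by omega)
      rw [show (s : ℕ) + (t - s) = t by omega, show (t : ℕ) - (n + 1) = 0 by omega] at h2
      have h3 : countLT g 0 = 0 := by simp [countLT]
      simp only [countLT] at h1 h2 h3 ⊢
      omega
    · rw [Fin.lt_def] at hts
      have h1 := hp (t + (n + 1) - s) (by omega)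
      have h2 := countLT_sub g s (t + (n + 1) - s) (by omega)
      rw [show (s : ℕ) + (t + (n + 1) - s) = t + (n + 1) by omega,
        show (t : ℕ) + (n + 1) - (n + 1) = t by omega] at h2
      have h3 : countLT g (t + (n + 1)) = n := countLT_top g (by omega)
      simp only [countLT] at h1 h2 h3 ⊢
      omega
  · intro H k hk
    change k ≤ countLT (fun i => g i - s) k
    have h2 := countLT_sub g s k hk
    rcases lt_or_ge ((s : ℕ) + k) (n + 1) with hlt | hge
    · have h1 := (H ⟨s + k, hlt⟩).1 (by rw [Fin.le_def]; simp)
      simp only at h1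
      push_cast at h1
      omega
    · have h1 := (H ⟨s + k - (n + 1), by omega⟩).2 (by rw [Fin.lt_def]; simp; omega)
      simp only at h1
      have h3 : countLT g (s + k) = n := countLT_top g (by omega)
      push_cast [Nat.cast_sub hge] at h1
      omega

/-- Pollak's argument: exactly one cyclic shift of a function to `{0, …, n}` is a parking
function. -/
theorem existsUnique_isParking_sub {n : ℕ} (g : Fin n → Fin (n + 1)) :
    ∃! s : Fin (n + 1), IsParking fun i => g i - s := by
  simp only [isParking_sub_iff]
  let S : Fin (n + 1) → ℤ := fun t => countLT g t - t
  obtain ⟨s₀, -, hs₀⟩ := Finset.exists_min_image Finset.univ S Finset.univ_nonempty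
  -- Among the minimisers of S, take the leftmost.
  obtain ⟨s, hs, hmin⟩ := Finset.exists_min_image (Finset.univ.filter fun t => S t ≤ S s₀) id
    ⟨s₀, by simp⟩
  simp only [Finset.mem_filter, Finset.mem_univ, true_and, id] at hs hmin
  refine ⟨s, fun t => ⟨fun _ => hs.trans (hs₀ t (Finset.mem_univ t)), fun hts => ?_⟩, ?_⟩
  · refine hs.trans_lt (lt_of_not_ge fun hle => ?_)
    exact absurd (hmin t hle) (not_le.2 hts)
  · intro t ht
    rcases lt_trichotomy t s with hlt | heq | hgt
    · have h2 := hmin t ((ht s).1 hlt.le |>.trans hs)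
      exact absurd h2 (not_le.2 hlt)
    · exact heq
    · have h1 : S t < S s := (ht s).2 hgt
      have h2 : S s₀ ≤ S t := hs₀ t (Finset.mem_univ t)
      exact absurd (h1.trans_le hs) (not_lt.2 h2)

/-- The functions invariant under `w` are the shifts of the parking functions invariant
under `w`. -/
theorem card_invariant_eq {n : ℕ} (w : Equiv.Perm (Fin n)) :
    Nat.card {g : Fin n → Fin (n + 1) // g ∘ w = g} =
      (n + 1) * Nat.card {g : Fin n → Fin (n + 1) // IsParking g ∧ g ∘ w = g} := by
  have hcard : Nat.card (Fin (n + 1)) = n + 1 := Nat.card_fin (n + 1)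
  refine Eq.trans ?_ (congrArg (· * _) hcard)
  rw [mul_comm, ← Nat.card_prod]
  symm
  -- The bijection is (g, s) ↦ g + s. Uniqueness of the parking shift recovers s, and its existence
  -- gives surjectivity.
  refine Nat.card_congr (Equiv.ofBijective (fun x => ⟨fun i => x.1.1 i + x.2, ?_⟩) ⟨?_, ?_⟩)
  · funext i
    exact congrArg (· + x.2) (congrFun x.1.2.2 i)
  · rintro ⟨⟨g, hg, hgw⟩, s⟩ ⟨⟨g', hg', hgw'⟩, s'⟩ heq
    have heq' : ∀ i, g i + s = g' i + s' := fun i => congrFun (Subtype.ext_iff.1 heq) i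
    obtain ⟨u, -, hu⟩ := existsUnique_isParking_sub fun i => g i + s
    have h1 : s = u := hu s (by simpa using hg)
    have h2 : s' = u := hu s' (by simpa [heq'] using hg')
    obtain rfl := h1.trans h2.symm
    simpa [funext_iff] using heq'
  · rintro ⟨g, hgw⟩
    obtain ⟨s, hs, -⟩ := existsUnique_isParking_sub g
    refine ⟨⟨⟨fun i => g i - s, hs, ?_⟩, s⟩, ?_⟩
    · funext i
      exact congrArg (· - s) (congrFun hgw i)
    · simp

/-! ### Counting invariant functions by cycles -/

theorem card_quotient_sameCycle {α : Type*} [Fintype α] [DecidableEq α] (w : Equiv.Perm α) :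
    Nat.card (Quotient (Equiv.Perm.SameCycle.setoid w)) = w.partition.parts.card := by
  classical
  -- The cycle type omits fixed points, which `partition` adds as parts equal to 1. So moved points
  -- go to their cycle and fixed points to themselves; the fibres are the orbits.
  let F : α → w.cycleFactorsFinset ⊕ Function.fixedPoints w := fun x =>
    if hx : w x = x then Sum.inr ⟨x, hx⟩ else
      Sum.inl ⟨w.cycleOf x, Equiv.Perm.cycleOf_mem_cycleFactorsFinset_iff.2
        (Equiv.Perm.mem_support.2 hx)⟩
  have hF : Function.Surjective F := by
    rintro (⟨c, hc⟩ | ⟨x, hx⟩)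
    · obtain ⟨x, hx⟩ := (Equiv.Perm.mem_cycleFactorsFinset_iff.1 hc).1.nonempty_support
      have hcx := Equiv.Perm.cycle_is_cycleOf hx hc
      have hwx : x ∈ w.support := Equiv.Perm.mem_cycleFactorsFinset_support_le hc hx
      refine ⟨x, ?_⟩
      simp only [F]
      rw [dif_neg (Equiv.Perm.mem_support.1 hwx)]
      simp [hcx]
    · exact ⟨x, dif_pos hx⟩
  have hker : Equiv.Perm.SameCycle.setoid w = Setoid.ker F := by
    ext x y
    rw [Setoid.ker_def]
    change w.SameCycle x y ↔ _
    by_cases hx : w x = x <;> by_cases hy : w y = y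
    · simp only [F, dif_pos hx, dif_pos hy, Sum.inr.injEq]
      rw [Subtype.ext_iff]
      exact ⟨fun hxy => hxy.eq_of_left hx, fun hxy => (show x = y from hxy) ▸ Equiv.Perm.SameCycle.refl w x⟩
    · simp only [F, dif_pos hx, dif_neg hy, reduceCtorEq, iff_false]
      exact fun hxy => hy (hxy.apply_eq_self_iff.1 hx)
    · simp only [F, dif_neg hx, dif_pos hy, reduceCtorEq, iff_false]
      exact fun hxy => hx (hxy.apply_eq_self_iff.2 hy)
    · simp only [F, dif_neg hx, dif_neg hy, Sum.inl.injEq, Subtype.mk.injEq]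
      exact Equiv.Perm.sameCycle_iff_cycleOf_eq_of_mem_support (Equiv.Perm.mem_support.2 hx)
        (Equiv.Perm.mem_support.2 hy)
  rw [hker, Nat.card_congr (Setoid.quotientKerEquivOfSurjective F hF), Nat.card_sum,
    Equiv.Perm.parts_partition, Multiset.card_add, Multiset.card_replicate,
    Equiv.Perm.cycleType_def, Multiset.card_map, Nat.card_eq_fintype_card, Fintype.card_coe]
  congr 1
  rw [← Equiv.Perm.sum_cycleType, ← Equiv.Perm.card_fixedPoints, Nat.card_eq_fintype_card]

/-- An invariant function is constant on cycles, so it is a free choice of one value per cycle. -/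
theorem card_invariant_eq_pow {α : Type*} [Fintype α] [DecidableEq α] (w : Equiv.Perm α)
    (X : Type*) [Finite X] :
    Nat.card {g : α → X // g ∘ w = g} = Nat.card X ^ w.partition.parts.card := by
  rw [← card_quotient_sameCycle, ← Nat.card_fun]
  symm
  refine Nat.card_congr
    { toFun := fun G => ⟨fun x => G (Quotient.mk _ x), ?_⟩
      invFun := fun g => Quotient.lift g.1 ?_
      left_inv := ?_
      right_inv := ?_ }
  · funext x
    refine congrArg G (Quotient.sound ?_)
    exact Equiv.Perm.sameCycle_apply_left.2 (Equiv.Perm.SameCycle.refl w x)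
  · rintro x _ ⟨i, rfl⟩
    have hg : ∀ x, g.1 (w x) = g.1 x := congrFun g.2
    induction i with
    | zero => rfl
    | succ i ih => rw [add_comm, zpow_add, zpow_one, Equiv.Perm.mul_apply, hg, ← ih]
    | pred i ih =>
      rw [ih, ← hg ((w ^ (-(i : ℤ) - 1)) x), ← Equiv.Perm.mul_apply, ← zpow_one_add,
        add_sub_cancel]
  · intro G
    funext q
    induction q using Quotient.inductionOn
    rfl
  · intro g
    rfl

/-! ### Fixed parking functions and the permutation character -/

/-- Counting entries is insensitive to order, so the sorted sequence may replace `a`. This form of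
the condition matches `IsParking` after subtracting 1 from the entries. -/
theorem rearrange_le_iff {n : ℕ} (a : Fin n → ℕ) :
    (∀ i : Fin n, rearrange a i ≤ (i : ℕ) + 1) ↔
      ∀ k ≤ n, k ≤ (Finset.univ.filter fun i => a i ≤ k).card := by
  have hmono : Monotone (rearrange a) := Tuple.monotone_sort a
  have hcard : ∀ k, (Finset.univ.filter fun i => a i ≤ k).card =
      (Finset.univ.filter fun i => rearrange a i ≤ k).card := by
    intro k
    symm
    refine Finset.card_bij (fun i _ => Tuple.sort a i) ?_ ?_ ?_
    · intro i hi
      simp only [Finset.mem_filter, Finset.mem_univ, true_and] at hi ⊢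
      exact hi
    · intro i _ j _ hij
      exact (Tuple.sort a).injective hij
    · intro i hi
      refine ⟨(Tuple.sort a).symm i, ?_, Equiv.apply_symm_apply _ i⟩
      rw [Finset.mem_filter] at hi ⊢
      rw [rearrange, Function.comp_apply, Equiv.apply_symm_apply]
      exact ⟨Finset.mem_univ _, hi.2⟩
  simp only [hcard]
  constructor
  · intro H k hk
    calc k = (Finset.univ.filter fun i : Fin n => (i : ℕ) < k).card := by
          rw [Fin.card_filter_val_lt, min_eq_right hk]
      _ ≤ _ := Finset.card_le_card fun i hi => by
          simp only [Finset.mem_filter, Finset.mem_univ, true_and] at hi ⊢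
          exact (H i).trans hi
  · intro H i
    by_contra hlt
    rw [not_le] at hlt
    have h1 := H (i + 1) i.2
    -- If the sorted entry at i exceeds i + 1, so do all later ones; at most i entries are then ≤ i
    -- + 1, one too few.
    have h2 : (Finset.univ.filter fun j => rearrange a j ≤ (i : ℕ) + 1).card ≤
        (Finset.univ.filter fun j : Fin n => (j : ℕ) < i).card :=
      Finset.card_le_card fun j hj => by
        simp only [Finset.mem_filter, Finset.mem_univ, true_and] at hj ⊢
        by_contra hij
        exact absurd (hlt.trans_le (hmono (not_lt.1 hij))) (not_lt.2 hj)
    rw [Fin.card_filter_val_lt, min_eq_right i.2.le] at h2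
    omega

theorem ParkingFunction.le {n : ℕ} (a : ParkingFunction n) (i : Fin n) : a.1 i ≤ n := by
  have h1 := a.2.2 ((Tuple.sort a.1).symm i)
  simp only [rearrange, Function.comp_apply, Equiv.apply_symm_apply] at h1
  exact h1.trans ((Tuple.sort a.1).symm i).2

/-- Parking functions as functions to `{0, …, n}`. -/
def parkingEquiv (n : ℕ) : ParkingFunction n ≃ {g : Fin n → Fin (n + 1) // IsParking g} where
  toFun a := ⟨fun i => ⟨a.1 i - 1, by
      have := a.le i
      omega⟩, fun k hk => by
      refine ((rearrange_le_iff a.1).1 a.2.2 k hk).trans (Finset.card_le_card fun i hi => ?_)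
      have := a.2.1 i
      simp only [Finset.mem_filter, Finset.mem_univ, true_and] at hi ⊢
      omega⟩
  invFun g := ⟨fun i => g.1 i + 1, fun i => Nat.le_add_left 1 _, by
    rw [rearrange_le_iff]
    intro k hk
    refine (g.2 k hk).trans (Finset.card_le_card fun i hi => ?_)
    simp only [Finset.mem_filter, Finset.mem_univ, true_and] at hi ⊢
    omega⟩
  left_inv a := by
    refine Subtype.ext (funext fun i => ?_)
    exact Nat.sub_add_cancel (a.2.1 i)
  right_inv g := rfl

theorem parkingEquiv_smul {n : ℕ} (w : Equiv.Perm (Fin n)) (a : ParkingFunction n) :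
    (parkingEquiv n (w • a)).1 = (parkingEquiv n a).1 ∘ ⇑w⁻¹ := rfl

theorem card_fixedBy_parkingFunction {n : ℕ} (w : Equiv.Perm (Fin n)) :
    (n + 1) * Nat.card (MulAction.fixedBy (ParkingFunction n) w) =
      (n + 1) ^ w.partition.parts.card := by
  have hfix : Nat.card (MulAction.fixedBy (ParkingFunction n) w) =
      Nat.card {g : Fin n → Fin (n + 1) // IsParking g ∧ g ∘ w = g} := by
    refine Nat.card_congr (((parkingEquiv n).subtypeEquiv fun a => ?_).trans
      (Equiv.subtypeSubtypeEquivSubtypeInter IsParking fun g => g ∘ w = g))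
    rw [MulAction.mem_fixedBy, ← (parkingEquiv n).injective.eq_iff, Subtype.ext_iff,
      parkingEquiv_smul]
    refine ⟨fun ha => ?_, fun ha => ?_⟩
    · conv_lhs => rw [← ha]
      funext i
      simp
    · conv_lhs => rw [← ha]
      funext i
      simp
  rw [hfix, ← card_invariant_eq, card_invariant_eq_pow, Nat.card_fin]

/-- In the basis of points, g acts by a permutation matrix, whose diagonal marks the fixed points.
-/
theorem character_ofMulAction {G X : Type*} [Group G] [MulAction G X] [Finite X] (g : G) :
    (Representation.ofMulAction ℚ G X).character g = Nat.card (MulAction.fixedBy X g) := by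
  classical
  have := Fintype.ofFinite X
  let b : Module.Basis X ℚ (MonoidAlgebra ℚ X) :=
    Module.Basis.ofRepr (MonoidAlgebra.coeffLinearEquiv ℚ)
  have hb : ∀ x, b x = MonoidAlgebra.single x 1 := fun x => rfl
  rw [Representation.character, LinearMap.trace_eq_matrix_trace ℚ b, Matrix.trace]
  have hdiag : ∀ x, Matrix.diag (LinearMap.toMatrix b b (Representation.ofMulAction ℚ G X g)) x =
      if g • x = x then 1 else 0 := by
    intro x
    rw [Matrix.diag_apply, LinearMap.toMatrix_apply, hb, Representation.ofMulAction_single]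
    exact Finsupp.single_apply
  simp only [hdiag]
  rw [Finset.sum_boole, Nat.card_eq_fintype_card, ← Fintype.card_subtype]
  rfl

/-! ### Sizes of conjugacy classes -/

/-- The cycle type of a permutation of `Fin n`, as a partition of `n`. -/
def cyclePartition {n : ℕ} (w : Equiv.Perm (Fin n)) : n.Partition where
  parts := w.partition.parts
  parts_pos := w.partition.parts_pos
  -- `w.partition` is a partition of `Fintype.card (Fin n)`; the parts are kept and only the total
  -- is rewritten as n.
  parts_sum := w.partition.parts_sum.trans (Fintype.card_fin n)

theorem filter_two_le_add_replicate {n : ℕ} (l : n.Partition) :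
    l.parts.filter (2 ≤ ·) + Multiset.replicate (l.parts.count 1) 1 = l.parts := by
  conv_rhs => rw [← Multiset.filter_add_not (2 ≤ ·) l.parts]
  rw [← Multiset.filter_eq']
  congr 1
  refine Multiset.filter_congr fun k hk => ?_
  have := l.parts_pos hk
  omega

/-- The parts of size at least 2 determine a partition of n, since the number of ones is forced by
the total. -/
theorem cyclePartition_eq_iff {n : ℕ} (w : Equiv.Perm (Fin n)) (l : n.Partition) :
    cyclePartition w = l ↔ w.cycleType = l.parts.filter (2 ≤ ·) := by
  have hw : (cyclePartition w).parts.filter (2 ≤ ·) = w.cycleType :=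
    Equiv.Perm.filter_parts_partition_eq_cycleType
  refine ⟨fun hwl => by rw [← hw, hwl], fun hwl => Nat.Partition.ext ?_⟩
  have h1 := filter_two_le_add_replicate (cyclePartition w)
  have h2 := filter_two_le_add_replicate l
  have s1 := congrArg Multiset.sum h1
  have s2 := congrArg Multiset.sum h2
  rw [hw, hwl, Multiset.sum_add, Multiset.sum_replicate, (cyclePartition w).parts_sum] at s1
  rw [Multiset.sum_add, Multiset.sum_replicate, l.parts_sum] at s2
  have hcount : l.parts.count 1 = (cyclePartition w).parts.count 1 := by
    simpa using s2.trans s1.symm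
  rw [← h1, ← h2, hw, hwl, hcount]

theorem z_eq {n : ℕ} (l : n.Partition) : z l = l.parts.prod *
    ∏ i ∈ l.parts.toFinset, (l.parts.count i).factorial := by
  rw [z, Finset.prod_mul_distrib, Finset.prod_multiset_count]

theorem card_cyclePartition_mul_z {n : ℕ} (l : n.Partition) :
    (Finset.univ.filter fun w : Equiv.Perm (Fin n) => cyclePartition w = l).card * z l =
      n.factorial := by
  simp only [cyclePartition_eq_iff]
  set m := l.parts.filter (2 ≤ ·) with hm
  have hl := filter_two_le_add_replicate l
  rw [← hm] at hl
  have hsum : m.sum + l.parts.count 1 = n := by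
    have := congrArg Multiset.sum hl
    rw [Multiset.sum_add, Multiset.sum_replicate, l.parts_sum] at this
    simpa using this
  -- This class formula uses only the cycles of length at least 2, with (n - m.sum)! for the fixed
  -- points. The rest matches it with z_λ, where that factor is the term i = 1.
  have key := Equiv.Perm.card_of_cycleType_mul_eq (Fin n) m
  rw [Fintype.card_fin, if_pos ⟨by omega, fun a ha => (Multiset.mem_filter.1 ha).2⟩] at key
  rw [← key]
  congr 1
  have hprod : l.parts.prod = m.prod := by
    conv_lhs => rw [← hl]
    simp
  have hfac : ∏ i ∈ l.parts.toFinset, (l.parts.count i).factorial =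
      (l.parts.count 1).factorial * ∏ i ∈ m.toFinset, (m.count i).factorial := by
    have hcount : ∀ i ∈ m.toFinset, m.count i = l.parts.count i := by
      intro i hi
      rw [hm, Multiset.count_filter_of_pos]
      rw [Multiset.mem_toFinset, hm] at hi
      exact (Multiset.mem_filter.1 hi).2
    have h1 : 1 ∉ m.toFinset := by
      rw [Multiset.mem_toFinset, hm]
      exact fun h1 => absurd (Multiset.mem_filter.1 h1).2 (by norm_num)
    have hm' : ∏ i ∈ m.toFinset, (m.count i).factorial =
        ∏ i ∈ m.toFinset, (l.parts.count i).factorial :=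
      Finset.prod_congr rfl fun i hi => by rw [hcount i hi]
    rw [hm', ← Finset.prod_insert (f := fun i => (l.parts.count i).factorial) h1]
    refine Finset.prod_subset ?_ fun i _ hi => ?_
    · intro i hi
      rw [Multiset.mem_toFinset] at hi
      rw [Finset.mem_insert, Multiset.mem_toFinset, hm, Multiset.mem_filter]
      have := l.parts_pos hi
      by_cases h2 : i = 1
      · exact Or.inl h2
      · exact Or.inr ⟨hi, by omega⟩
    -- The index 1 was inserted even if λ has no part 1; it then contributes 0! = 1.
    · rw [Multiset.mem_toFinset] at hi
      rw [Multiset.count_eq_zero_of_notMem hi, Nat.factorial_zero]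
  rw [z_eq, hprod, hfac, show n - m.sum = l.parts.count 1 by omega]
  ring

theorem z_pos {n : ℕ} (l : n.Partition) : 0 < z l :=
  Nat.pos_of_ne_zero fun h0 => by
    have := card_cyclePartition_mul_z l
    rw [h0, mul_zero] at this
    exact n.factorial_ne_zero this.symm

/-! ### The power sum expansion of `PF n` and its shiftification -/

theorem character_parkingFunction {n : ℕ} (hn : 1 ≤ n) (w : Equiv.Perm (Fin n)) :
    (Representation.ofMulAction ℚ (Equiv.Perm (Fin n)) (ParkingFunction n)).character w =
      ((n : ℚ) + 1) ^ ((cyclePartition w).parts.card - 1) := by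
  rw [character_ofMulAction]
  -- As n ≥ 1 there is at least one cycle, so the natural subtraction in the exponent is genuine and
  -- one factor n + 1 can be cancelled.
  have hpos : 0 < (cyclePartition w).parts.card := by
    rw [Multiset.card_pos]
    intro h0
    have := (cyclePartition w).parts_sum
    rw [h0, Multiset.sum_zero] at this
    omega
  have key := congrArg (Nat.cast : ℕ → ℚ) (card_fixedBy_parkingFunction w)
  change _ = (((n + 1) ^ (cyclePartition w).parts.card : ℕ) : ℚ) at key
  obtain ⟨c, hc⟩ := Nat.exists_eq_succ_of_ne_zero hpos.ne'
  rw [hc] at key ⊢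
  push_cast [pow_succ'] at key
  exact mul_left_cancel₀ (by positivity) key

/-- The expansion of `PF_n` in power sums. -/
theorem PF_eq_sum {n : ℕ} (hn : 1 ≤ n) : PF n = ∑ l : n.Partition,
    ((z l : ℚ)⁻¹ * ((n : ℚ) + 1) ^ (l.parts.card - 1)) • pPart l := by
  have hfact : (n.factorial : ℚ) ≠ 0 := Nat.cast_ne_zero.2 n.factorial_ne_zero
  -- The summand depends only on the cycle type, and the class of λ has n!/z_λ elements.
  rw [PF, frobeniusChar, ← Finset.sum_fiberwise _ (cyclePartition : _ → n.Partition),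
    Finset.smul_sum]
  refine Finset.sum_congr rfl fun l _ => ?_
  rw [Finset.sum_congr (g := fun _ => ((n : ℚ) + 1) ^ (l.parts.card - 1) • pPart l) rfl]
  · rw [Finset.sum_const, ← Nat.cast_smul_eq_nsmul ℚ, smul_smul, smul_smul]
    congr 1
    have hz : (z l : ℚ) ≠ 0 := Nat.cast_ne_zero.2 (z_pos l).ne'
    rw [← card_cyclePartition_mul_z l] at hfact ⊢
    push_cast at hfact ⊢
    have := left_ne_zero_of_mul hfact
    field_simp
  · intro w hw
    obtain rfl := (Finset.mem_filter.1 hw).2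
    rw [character_parkingFunction hn]
    rfl

end ShiftedParking

theorem theorem2 (n : ℕ) (hn : 1 ≤ n) :
    ShiftedParking.SH n = ∑ l ∈ Nat.Partition.odds n,
      ((ShiftedParking.z l : ℚ)⁻¹ * 2 ^ l.parts.card * ((n : ℚ) + 1) ^ (l.parts.card - 1)) •
        (ShiftedParking.pPart l : MvPowerSeries ℕ ℚ) := by
  rw [ShiftedParking.SH, ← ShiftedParking.shiftHom_apply, ShiftedParking.PF_eq_sum hn, map_sum,
    -- The sum over odd partitions becomes a sum over all partitions with zero terms, matching the
    -- vanishing of p_λ under shiftification when λ has an even part.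
    Nat.Partition.odds, Nat.Partition.restricted, Finset.sum_filter]
  refine Finset.sum_congr rfl fun l _ => ?_
  rw [map_smul, ShiftedParking.shiftHom_pPart, smul_smul]
  split_ifs
  · congr 1
    ring
  · rw [mul_zero, zero_smul]
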